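/- Let $n$ be a dimension and let $\mathcal B$ be a collection of bounded open convex subsets of $\mathbb R^n$ that is homothecy invariant: $v+cR\in\mathcal B$ for all $R\in\mathcal B$, $v\in\mathbb R^n$ and $c>0$. Suppose that $\mathcal B$ is a density basis, that is, it differentiates $L^\infty(\mathbb R^n)$: for every $f\in L^\infty(\mathbb R^n)$ and almost every $x\in\mathbb R^n$, there are members of $\mathcal B$ of arbitrarily small diameter containing $x$, and $$\frac1{|R|}\int_R f\longrightarrow f(x)\qquad\text{as } \operatorname{diam} R\to 0,\ x\in R\in\mathcal B .$$ Define $$M_{\mathcal B}f(x)=\sup_{x\in R\in\mathcal B}\frac1{|R|}\int_R|f|$$ (with the value $0$ if no member of $\mathcal B$ contains $x$), the sharp Tauberian constant $$C_{\mathcal B}(\alpha)=\sup_{E:\ 0<|E|<\infty}\frac1{|E|}\bigl|\{x\in\mathbb R^n: M_{\mathcal B}\chi_E(x)>\alpha\}\bigr|,\qquad 0<\alpha<1,$$ where $E$ ranges over the measurable subsets of $\mathbb R^n$, and the halo function $\phi_{\mathcal B}$ on $[0,\infty)$ by $\phi_{\mathcal B}(a)=a$ for $0\le a\le 1$ and $\phi_{\mathcal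 B}(a)=C_{\mathcal B}(1/a)$ for $a>1$. For an interval $I\subset\mathbb R$ and $0<p<1$, write $f\in C^p(I)$ if for every compact $K\subset I$ there is a constant $A_K$ with $|f(x)-f(y)|\le A_K|x-y|^p$ for all $x,y\in K$. Let $0<p<1$ and suppose that there are constants $A>0$ and $\alpha_0\in(0,1)$ such that $C_{\mathcal B}(\alpha)-1\le A(1-\alpha)^p$ for all $\alpha\in(\alpha_0,1)$. Then $C_{\mathcal B}$ is finite on $(0,1)$ and $$C_{\mathcal B}\in C^p\bigl((0,1)\bigr),$$ and $\phi_{\mathcal B}$ is finite on $[0,\infty)$ and $$\phi_{\mathcal B}\in C^p\bigl([0,\infty)\bigr).$$ -/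

import Mathlib

open Set Filter Topology MeasureTheory
open scoped ENNReal NNReal

noncomputable section

namespace Halo

/-- A basis in `ℝⁿ`: a collection of bounded open sets. -/
def IsBasis {n : ℕ} (B : Set (Set (EuclideanSpace ℝ (Fin n)))) : Prop :=
  ∀ R ∈ B, IsOpen R ∧ Bornology.IsBounded R

/-- Invariance under all translations and all dilations of positive ratio. -/
def HomothecyInvariant {n : ℕ} (B : Set (Set (EuclideanSpace ℝ (Fin n)))) : Prop :=
  ∀ R ∈ B, ∀ c : ℝ, 0 < c → ∀ v : EuclideanSpace ℝ (Fin n), (fun x => v + c • x) '' R ∈ B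

/-- `B` differentiates `f`: for almost every `x`, there are members of `B` of arbitrarily small
diameter containing `x`, and the averages of `f` over the members of `B` containing `x` converge
to `f x` as their diameters tend to zero. -/
def Differentiates {n : ℕ} (B : Set (Set (EuclideanSpace ℝ (Fin n))))
    (f : EuclideanSpace ℝ (Fin n) → ℝ) : Prop :=
  ∀ᵐ x ∂(volume : Measure (EuclideanSpace ℝ (Fin n))),
    (∀ r > 0, ∃ R ∈ B, x ∈ R ∧ Metric.diam R < r) ∧
    ∀ ε > 0, ∃ r > 0, ∀ R ∈ B, x ∈ R → Metric.diam R < r → |(⨍ y in R, f y) - f x| < ε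

/-- A density basis: a basis that differentiates every function in `L^∞(ℝⁿ)`. -/
def IsDensityBasis {n : ℕ} (B : Set (Set (EuclideanSpace ℝ (Fin n)))) : Prop :=
  IsBasis B ∧ ∀ f : EuclideanSpace ℝ (Fin n) → ℝ, MemLp f ∞ volume → Differentiates B f

/-- The maximal operator `M_B f (x) = sup_{x ∈ R ∈ B} |R|⁻¹ ∫_R |f|`, with value `0` at points
that lie in no member of `B`. -/
def maximalOperator {n : ℕ} (B : Set (Set (EuclideanSpace ℝ (Fin n))))
    (f : EuclideanSpace ℝ (Fin n) → ℝ) (x : EuclideanSpace ℝ (Fin n)) : ℝ≥0∞ :=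
  ⨆ (R : Set (EuclideanSpace ℝ (Fin n))) (_ : R ∈ B) (_ : x ∈ R), ⨍⁻ y in R, ‖f y‖ₑ ∂volume

/-- The halo set `{x : M_B χ_E (x) > α}`. -/
def haloSet {n : ℕ} (B : Set (Set (EuclideanSpace ℝ (Fin n)))) (α : ℝ)
    (E : Set (EuclideanSpace ℝ (Fin n))) : Set (EuclideanSpace ℝ (Fin n)) :=
  {x | ENNReal.ofReal α < maximalOperator B (E.indicator fun _ => (1 : ℝ)) x}

/-- The sharp Tauberian constant
`C_B(α) = sup_{0 < |E| < ∞} |E|⁻¹ |{x : M_B χ_E (x) > α}|`, a priori possibly infinite. -/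
def sharpTauberian {n : ℕ} (B : Set (Set (EuclideanSpace ℝ (Fin n)))) (α : ℝ) : ℝ≥0∞ :=
  ⨆ (E : Set (EuclideanSpace ℝ (Fin n))) (_ : MeasurableSet E) (_ : 0 < volume E)
    (_ : volume E < ∞), volume (haloSet B α E) / volume E

/-- The halo function on `[0, ∞)`: `φ_B(a) = a` for `0 ≤ a ≤ 1`, and
`φ_B(a) = sup_{0 < |E| < ∞} |E|⁻¹ |{x : M_B χ_E (x) > 1 / a}|` for `a > 1`. -/
def haloFunction {n : ℕ} (B : Set (Set (EuclideanSpace ℝ (Fin n)))) (a : ℝ) : ℝ≥0∞ :=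
  if a ≤ 1 then ENNReal.ofReal a else sharpTauberian B (1 / a)

/-- The Solyanik estimate `C_B(α) - 1 ≤ A (1 - α)^p` for `α < 1` sufficiently close to `1`. -/
def SolyanikEstimate {n : ℕ} (B : Set (Set (EuclideanSpace ℝ (Fin n)))) (p : ℝ≥0) : Prop :=
  ∃ A : ℝ, ∀ᶠ α : ℝ in 𝓝[<] 1, sharpTauberian B α - 1 ≤ ENNReal.ofReal (A * (1 - α) ^ (p : ℝ))

/-- The class `C^p(I)`: on every compact subset of `I`, `f` is Hölder continuous of exponent `p`,
with a constant that may depend on the compact set. -/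
def LocallyHolder (p : ℝ≥0) (f : ℝ → ℝ) (I : Set ℝ) : Prop :=
  ∀ K ⊆ I, IsCompact K → ∃ A : ℝ≥0, HolderOnWith A p f K

end Halo

end

/-!
Let `E` have density at most `1 - η` in a convex `R ∈ B`. About almost every point of `E ∩ R`, the
homothetic copies of `R` shrinking to that point pass through one in which `E` has density in
`(1 - η, 1 - η / 2]`. Such a copy lies in the halo set `H` of `E` at level `1 - η`, and at least
`η / 2` of it lies outside `E`. A Vitali covering by these copies, whose overlaps are controlled
through the difference body `R - R`, gives `|H ∩ R| ≥ (1 + c η) |E ∩ R|` with `c` depending only on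
`n`. Taking halo sets of halo sets, `C_B(α) ≤ C_B(α (1 + c η)) C_B(1 - η)`, and so
`φ_B(a + c η) ≤ φ_B(a) C_B(1 - η)` for `a ≥ 1`. Under a Solyanik estimate the last factor is
`1 + O(η ^ p)`: iteration gives finiteness, and monotonicity turns the same inequality into a
Hölder bound on `[1, b]`.
-/

namespace Halo

open scoped Pointwise
open AffineMap Module

theorem image_homothety_eq_vadd_smul {R V : Type*} [CommRing R] [AddCommGroup V] [Module R V]
    (x : V) (t : R) (K : Set V) :
    homothety x t '' K = (x - t • x) +ᵥ t • K := by
  rw [← image_vadd, ← image_smul, image_image]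
  refine image_congr fun y _ => ?_
  rw [homothety_apply, vsub_eq_sub, vadd_eq_add, vadd_eq_add]
  module

theorem diam_image_homothety {V : Type*} [SeminormedAddCommGroup V] [NormedSpace ℝ V] (x : V)
    {t : ℝ} (ht : 0 ≤ t) (K : Set V) : Metric.diam (homothety x t '' K) = t * Metric.diam K := by
  rw [image_homothety_eq_vadd_smul, _root_.diam_vadd, diam_smul₀, Real.norm_of_nonneg ht]

section Homothety

variable {𝕜 V : Type*} [Field 𝕜] [LinearOrder 𝕜] [IsStrictOrderedRing 𝕜] [AddCommGroup V]
  [Module 𝕜 V] {K : Set V}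

theorem image_homothety_subset {x : V} (hK : StarConvex 𝕜 x K) {t : 𝕜} (ht : t ∈ Icc 0 1) :
    homothety x t '' K ⊆ K := by
  rintro _ ⟨y, hy, rfl⟩
  rw [homothety_apply, vsub_eq_sub, vadd_eq_add, add_comm]
  exact hK.add_smul_sub_mem hy ht.1 ht.2

theorem image_homothety_mul_subset {x : V} (hK : StarConvex 𝕜 x K) (s : 𝕜) {t : 𝕜}
    (ht : t ∈ Icc 0 1) : homothety x (s * t) '' K ⊆ homothety x s '' K := by
  rw [homothety_mul, AffineMap.coe_comp, image_comp]
  exact image_mono (image_homothety_subset hK ht)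

theorem sub_mem_smul_sub_of_homothety_inter_nonempty (hK : Convex 𝕜 K) {a b : V} (ha : a ∈ K)
    (hb : b ∈ K) {s t : 𝕜} (hs : 0 ≤ s) (ht : 0 ≤ t) (hst : s ≤ 2 * t)
    (h : (homothety a s '' K ∩ homothety b t '' K).Nonempty) :
    a - b ∈ (3 * t) • (K - K) := by
  obtain ⟨_, ⟨k, hk, rfl⟩, ⟨l, hl, hkl⟩⟩ := h
  have hab : t • (l - b) + s • (a - k) + (2 * t - s) • (a - a) = a - b := by
    simp only [homothety_apply, vsub_eq_sub, vadd_eq_add] at hkl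
    rw [eq_sub_of_add_eq hkl]
    module
  have hD : Convex 𝕜 (K - K) := hK.sub hK
  rw [show 3 * t = t + s + (2 * t - s) by ring, hD.add_smul (by positivity) (by linarith),
    hD.add_smul ht hs, ← hab]
  exact add_mem_add (add_mem_add (smul_mem_smul_set (sub_mem_sub hl hb))
    (smul_mem_smul_set (sub_mem_sub ha hk))) (smul_mem_smul_set (sub_mem_sub ha ha))

end Homothety

theorem lintegral_measure_inter_preimage_add_right {G : Type*} [MeasurableSpace G] [AddGroup G]
    [MeasurableAdd₂ G] (μ : Measure G) [SFinite μ] [μ.IsAddLeftInvariant] {K : Set G}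
    (hK : MeasurableSet K) : ∫⁻ x, μ (K ∩ (· + x) ⁻¹' K) ∂μ = μ K * μ K := by
  have h := (measurePreserving_prod_add_swap μ μ).measure_preimage (hK.prod hK).nullMeasurableSet
  rwa [Measure.prod_prod, Measure.prod_apply (by measurability)] at h

section HaarMeasure

variable {V : Type*} [NormedAddCommGroup V] [NormedSpace ℝ V] [FiniteDimensional ℝ V]
  [MeasurableSpace V] [BorelSpace V] (μ : Measure V) [μ.IsAddHaarMeasure] {E F G K : Set V}

/- Every `x = (u - v) / 2` with `u, v ∈ K` translates the half-size copy of `K` about `v` into the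
half-size copy about `u`, so `K` and `K - x` overlap in measure at least `2⁻ᵈ μ K`; integrate over
the set of such `x`. -/
theorem measure_sub_self_le (hK : Convex ℝ K) (ho : IsOpen K) :
    μ (K - K) ≤ 4 ^ finrank ℝ V * μ K := by
  rcases K.eq_empty_or_nonempty with rfl | hne
  · simp
  rcases eq_or_ne (μ K) ∞ with htop | hfin
  · simp [htop]
  set c : ℝ≥0∞ := (2 ^ finrank ℝ V)⁻¹ with hc
  have hhalf : ENNReal.ofReal |(1 / 2 : ℝ) ^ finrank ℝ V| = c := by
    rw [hc, abs_of_pos (by positivity), one_div, inv_pow, ENNReal.ofReal_inv_of_pos (by positivity),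
      ENNReal.ofReal_pow (by norm_num), ENNReal.ofReal_ofNat]
  have hoverlap : ∀ x ∈ (1 / 2 : ℝ) • (K - K), c * μ K ≤ μ (K ∩ (· + x) ⁻¹' K) := by
    rintro _ ⟨_, ⟨u, hu, v, hv, rfl⟩, rfl⟩
    rw [← hhalf, ← Measure.addHaar_image_homothety μ v]
    refine measure_mono (subset_inter (image_homothety_subset (hK hv) (by norm_num)) ?_)
    rintro _ ⟨k, hk, rfl⟩
    have htranslate : homothety v (1 / 2 : ℝ) k + (1 / 2 : ℝ) • (u - v) =
        u + (1 / 2 : ℝ) • (k - u) := by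
      rw [homothety_apply, vsub_eq_sub, vadd_eq_add]
      module
    exact mem_preimage.2 (htranslate ▸ hK.add_smul_sub_mem hu hk (by norm_num))
  have key : c * μ K * (c * μ (K - K)) ≤ μ K * μ K := by
    have hmeas : c * μ (K - K) = μ ((1 / 2 : ℝ) • (K - K)) := by rw [Measure.addHaar_smul, hhalf]
    rw [← lintegral_measure_inter_preimage_add_right μ ho.measurableSet, hmeas,
      ← setLIntegral_const]
    exact (setLIntegral_mono' (ho.sub_left.smul₀ (by norm_num)).measurableSet hoverlap).trans
      (setLIntegral_le_lintegral _ _)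
  have h2 : (2 : ℝ≥0∞) ^ finrank ℝ V * c = 1 := ENNReal.mul_inv_cancel (by simp) (by simp)
  rw [← ENNReal.mul_le_mul_iff_right (ho.measure_pos μ hne).ne' hfin]
  calc μ K * μ (K - K)
      = (2 ^ finrank ℝ V * c) * (2 ^ finrank ℝ V * c) * (μ K * μ (K - K)) := by
        rw [h2, one_mul, one_mul]
    _ = 2 ^ finrank ℝ V * 2 ^ finrank ℝ V * (c * μ K * (c * μ (K - K))) := by ring
    _ ≤ 2 ^ finrank ℝ V * 2 ^ finrank ℝ V * (μ K * μ K) := by gcongr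
    _ = μ K * (4 ^ finrank ℝ V * μ K) := by rw [← mul_pow]; norm_num; ring

theorem measure_image_homothety (x : V) {t : ℝ} (ht : 0 ≤ t) (K : Set V) :
    μ (homothety x t '' K) = ENNReal.ofReal t ^ finrank ℝ V * μ K := by
  rw [Measure.addHaar_image_homothety, abs_of_nonneg (by positivity), ENNReal.ofReal_pow ht]

theorem measure_smul_sub_self_le (hK : Convex ℝ K) (ho : IsOpen K) (b : V) {t : ℝ} (ht : 0 ≤ t) :
    μ ((3 * t) • (K - K)) ≤ 12 ^ finrank ℝ V * μ (homothety b t '' K) := by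
  rw [Measure.addHaar_smul_of_nonneg μ (by positivity), measure_image_homothety μ b ht,
    ENNReal.ofReal_pow (by positivity), ENNReal.ofReal_mul (by norm_num), ENNReal.ofReal_ofNat]
  calc (3 * ENNReal.ofReal t) ^ finrank ℝ V * μ (K - K)
      ≤ (3 * ENNReal.ofReal t) ^ finrank ℝ V * (4 ^ finrank ℝ V * μ K) := by
        gcongr
        exact measure_sub_self_le μ hK ho
    _ = (3 * 4) ^ finrank ℝ V * (ENNReal.ofReal t ^ finrank ℝ V * μ K) := by
        rw [mul_pow, mul_pow]; ring
    _ = 12 ^ finrank ℝ V * (ENNReal.ofReal t ^ finrank ℝ V * μ K) := by norm_num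

theorem exists_disjoint_homothety_measure_le (hK : Convex ℝ K) (ho : IsOpen K) (hG : G ⊆ K)
    {t : V → ℝ} {M : ℝ} (ht : ∀ x ∈ G, t x ∈ Ioc 0 M) :
    ∃ u ⊆ G, u.Countable ∧ u.PairwiseDisjoint (fun x => homothety x (t x) '' K) ∧
      μ G ≤ 12 ^ finrank ℝ V * ∑' b : u, μ (homothety (b : V) (t b) '' K) := by
  have hself : ∀ x ∈ G, (homothety x (t x) '' K).Nonempty := fun x hx => ⟨_, ⟨x, hG hx, rfl⟩⟩
  obtain ⟨u, huG, hdisj, hcov⟩ := Vitali.exists_disjoint_subfamily_covering_enlargement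
    (fun x => homothety x (t x) '' K) G t 2 one_lt_two (fun x hx => (ht x hx).1.le) M
    (fun x hx => (ht x hx).2) hself
  have hu : u.Countable := hdisj.countable_of_isOpen
    (fun x hx => homothety_isOpenMap x _ (ht x (huG hx)).1.ne' _ ho) fun x hx => hself x (huG hx)
  have hcover : G ⊆ ⋃ b ∈ u, b +ᵥ (3 * t b) • (K - K) := fun a ha => by
    obtain ⟨b, hb, hab, htab⟩ := hcov a ha
    refine mem_biUnion hb (mem_vadd_set_iff_neg_vadd_mem.2 ?_)
    rw [vadd_eq_add, neg_add_eq_sub]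
    exact sub_mem_smul_sub_of_homothety_inter_nonempty hK (hG ha) (hG (huG hb)) (ht a ha).1.le
      (ht b (huG hb)).1.le htab hab
  refine ⟨u, huG, hu, hdisj, ?_⟩
  calc μ G ≤ ∑' b : u, μ ((b : V) +ᵥ (3 * t b) • (K - K)) :=
        (measure_mono hcover).trans (measure_biUnion_le μ hu _)
    _ ≤ ∑' b : u, 12 ^ finrank ℝ V * μ (homothety (b : V) (t b) '' K) := by
        gcongr with b
        rw [measure_vadd]
        exact measure_smul_sub_self_le μ hK ho _ (ht b (huG b.2)).1.le
    _ = _ := ENNReal.tsum_mul_left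

theorem mul_measure_le_of_ae_exists_homothety (hK : Convex ℝ K) (ho : IsOpen K) (hG : G ⊆ K)
    {c : ℝ≥0∞} (h : ∀ᵐ x ∂μ, x ∈ G → ∃ t ∈ Ioc (0 : ℝ) 1,
      c * μ (homothety x t '' K) ≤ μ (homothety x t '' K ∩ F)) :
    c * μ G ≤ 12 ^ finrank ℝ V * μ F := by
  set P : V → ℝ → Prop := fun x t =>
    t ∈ Ioc 0 1 ∧ c * μ (homothety x t '' K) ≤ μ (homothety x t '' K ∩ F)
  set G' := {x ∈ G | ∃ t, P x t}
  have hGG' : μ G ≤ μ G' :=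
    measure_mono_ae (by filter_upwards [h] with x hx hxG using ⟨hxG, hx hxG⟩)
  choose! t ht using fun (x : V) (hx : x ∈ G') => hx.2
  obtain ⟨u, huG', hu, hdisj, hle⟩ := exists_disjoint_homothety_measure_le μ hK ho
    ((sep_subset _ _).trans hG) fun x hx => (ht x hx).1
  have hmeas : ∀ b ∈ u, MeasurableSet (homothety b (t b) '' K) := fun b hb =>
    (homothety_isOpenMap b _ (ht b (huG' hb)).1.1.ne' _ ho).measurableSet
  calc c * μ G ≤ c * (12 ^ finrank ℝ V * ∑' b : u, μ (homothety (b : V) (t b) '' K)) := by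
        gcongr
        exact hGG'.trans hle
    _ = 12 ^ finrank ℝ V * ∑' b : u, c * μ (homothety (b : V) (t b) '' K) := by
        rw [ENNReal.tsum_mul_left]
        ring
    _ ≤ 12 ^ finrank ℝ V * ∑' b : u, μ.restrict F (homothety (b : V) (t b) '' K) := by
        gcongr with b
        rw [Measure.restrict_apply (hmeas b b.2)]
        exact (ht b (huG' b.2)).2
    _ = 12 ^ finrank ℝ V * μ.restrict F (⋃ b ∈ u, homothety b (t b) '' K) := by
        rw [measure_biUnion hu hdisj hmeas]
    _ ≤ 12 ^ finrank ℝ V * μ F := by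
        gcongr _ * ?_
        exact (measure_mono (subset_univ _)).trans_eq (Measure.restrict_apply_univ _)

/- Shrink `K` by a ratio `l` so close to `1` that one step changes its measure by a factor less
than `δ / γ`, and stop as soon as the density exceeds `γ`. -/
theorem exists_homothety_density_between {x : V} (hK : StarConvex ℝ x K) {γ δ : ℝ≥0∞} (hγδ : γ < δ)
    (hle : μ (E ∩ K) ≤ γ * μ K)
    (hsmall : ∀ᶠ t in 𝓝[>] (0 : ℝ), γ * μ (homothety x t '' K) < μ (E ∩ homothety x t '' K)) :
    ∃ t ∈ Ioc (0 : ℝ) 1, γ * μ (homothety x t '' K) < μ (E ∩ homothety x t '' K) ∧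
      μ (E ∩ homothety x t '' K) ≤ δ * μ (homothety x t '' K) := by
  obtain ⟨l, hγl, hl0, hl1⟩ :
      ∃ l : ℝ, γ < ENNReal.ofReal l ^ finrank ℝ V * δ ∧ l ∈ Ioo (0 : ℝ) 1 := by
    have hc : Tendsto (fun l : ℝ => ENNReal.ofReal l ^ finrank ℝ V * δ) (𝓝[<] 1) (𝓝 δ) := by
      have h1 : Tendsto (fun l : ℝ => ENNReal.ofReal l ^ finrank ℝ V) (𝓝 1) (𝓝 1) :=
        ((ENNReal.continuous_pow _).comp ENNReal.continuous_ofReal).tendsto' _ _ (by simp)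
      simpa using ENNReal.Tendsto.mul_const (h1.mono_left nhdsWithin_le_nhds) (Or.inl one_ne_zero)
    exact ((hc.eventually_const_lt hγδ).and (Ioo_mem_nhdsLT one_pos)).exists
  set S : ℕ → Set V := fun k => homothety x (l ^ k) '' K with hS
  have hex : ∃ k, γ * μ (S k) < μ (E ∩ S k) :=
    ((tendsto_pow_atTop_nhdsWithin_zero_of_lt_one hl0 hl1).eventually hsmall).exists
  classical
  obtain ⟨k, hk, hmin⟩ : ∃ k, γ * μ (S k) < μ (E ∩ S k) ∧
      ∀ j < k, μ (E ∩ S j) ≤ γ * μ (S j) :=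
    ⟨Nat.find hex, Nat.find_spec hex, fun j hj => not_lt.1 (Nat.find_min hex hj)⟩
  obtain ⟨j, rfl⟩ : ∃ j, k = j + 1 := by
    refine Nat.exists_eq_succ_of_ne_zero ?_
    rintro rfl
    exact absurd hle (by simpa [hS] using hk)
  refine ⟨l ^ (j + 1), ⟨by positivity, pow_le_one₀ hl0.le hl1.le⟩, hk, ?_⟩
  calc μ (E ∩ S (j + 1)) ≤ μ (E ∩ S j) := by
        gcongr
        simp only [hS, pow_succ]
        exact image_homothety_mul_subset hK _ ⟨hl0.le, hl1.le⟩
    _ ≤ γ * μ (S j) := hmin j j.lt_succ_self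
    _ ≤ ENNReal.ofReal l ^ finrank ℝ V * δ * μ (S j) := by gcongr
    _ = δ * μ (S (j + 1)) := by
        simp only [hS, measure_image_homothety μ x (pow_nonneg hl0.le _),
          ENNReal.ofReal_pow hl0.le]
        ring

end HaarMeasure

theorem mul_measure_le_measure_sdiff {α : Type*} [MeasurableSpace α] {μ : Measure α} {E S : Set α}
    (hE : MeasurableSet E) (hS : μ S ≠ ∞) {δ δ' : ℝ≥0∞} (hδ : δ + δ' = 1)
    (h : μ (E ∩ S) ≤ δ * μ S) : δ' * μ S ≤ μ (S \ E) := by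
  have hδtop : δ ≠ ∞ := ne_top_of_le_ne_top ENNReal.one_ne_top (hδ ▸ le_self_add)
  refine (ENNReal.add_le_add_iff_left (ENNReal.mul_ne_top hδtop hS)).1 ?_
  calc δ * μ S + δ' * μ S = μ (E ∩ S) + μ (S \ E) := by
        rw [← add_mul, hδ, one_mul, inter_comm, measure_inter_add_sdiff S hE]
    _ ≤ δ * μ S + μ (S \ E) := by gcongr

theorem setLAverage_enorm_indicator_one {α : Type*} [MeasurableSpace α] (μ : Measure α)
    {E : Set α} (hE : MeasurableSet E) (R : Set α) :
    ⨍⁻ y in R, ‖E.indicator (fun _ => (1 : ℝ)) y‖ₑ ∂μ = μ (E ∩ R) / μ R := by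
  simp only [enorm_indicator_eq_indicator_enorm, enorm_one]
  rw [setLAverage_eq, lintegral_indicator_const hE, one_mul, Measure.restrict_apply hE]

theorem setAverage_indicator_one {α : Type*} [MeasurableSpace α] (μ : Measure α) {E : Set α}
    (hE : MeasurableSet E) (R : Set α) :
    ⨍ y in R, E.indicator (fun _ => (1 : ℝ)) y ∂μ = (μ (E ∩ R) / μ R).toReal := by
  rw [setAverage_eq, integral_indicator_const _ hE, measureReal_restrict_apply hE, smul_eq_mul,
    smul_eq_mul, mul_one, inv_mul_eq_div, ENNReal.toReal_div, measureReal_def, measureReal_def]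

section HaloSet

variable {n : ℕ} {B : Set (Set (EuclideanSpace ℝ (Fin n)))}
  {E R : Set (EuclideanSpace ℝ (Fin n))} {α β η : ℝ}

theorem haloSet_anti (h : α ≤ β) : haloSet B β E ⊆ haloSet B α E :=
  fun _ hx => (ENNReal.ofReal_le_ofReal h).trans_lt hx

theorem antitone_sharpTauberian : Antitone (sharpTauberian B) := fun _ _ h =>
  iSup_mono fun _ => iSup_mono fun _ => iSup_mono fun _ => iSup_mono fun _ =>
    ENNReal.div_le_div_right (measure_mono (haloSet_anti h)) _

theorem IsBasis.measure_ne_top (hB : IsBasis B) (hR : R ∈ B) : volume R ≠ ∞ :=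
  (hB R hR).2.measure_lt_top.ne

theorem IsBasis.measure_ne_zero (hB : IsBasis B) (hR : R ∈ B) (hne : R.Nonempty) :
    volume R ≠ 0 :=
  ((hB R hR).1.measure_pos volume hne).ne'

theorem mem_haloSet_iff (hB : IsBasis B) (hE : MeasurableSet E) {x : EuclideanSpace ℝ (Fin n)} :
    x ∈ haloSet B α E ↔ ∃ R ∈ B, x ∈ R ∧ ENNReal.ofReal α * volume R < volume (E ∩ R) := by
  simp only [haloSet, maximalOperator, mem_ofPred_eq, lt_iSup_iff, exists_prop]
  refine exists_congr fun R => and_congr_right fun hR => and_congr_right fun hx => ?_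
  rw [setLAverage_enorm_indicator_one volume hE, ENNReal.lt_div_iff_mul_lt
    (Or.inl (hB.measure_ne_zero hR ⟨x, hx⟩)) (Or.inl (hB.measure_ne_top hR))]

theorem subset_haloSet (hB : IsBasis B) (hE : MeasurableSet E) (hR : R ∈ B)
    (h : ENNReal.ofReal α * volume R < volume (E ∩ R)) : R ⊆ haloSet B α E :=
  fun _ hx => (mem_haloSet_iff hB hE).2 ⟨R, hR, hx, h⟩

theorem isOpen_haloSet (hB : IsBasis B) (hE : MeasurableSet E) (α : ℝ) :
    IsOpen (haloSet B α E) := by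
  refine isOpen_iff_mem_nhds.2 fun x hx => ?_
  obtain ⟨R, hR, hxR, h⟩ := (mem_haloSet_iff hB hE).1 hx
  exact mem_of_superset ((hB R hR).1.mem_nhds hxR) (subset_haloSet hB hE hR h)

theorem measure_haloSet_le (hB : IsBasis B) (hE : MeasurableSet E) (hfin : volume E ≠ ∞) (α : ℝ) :
    volume (haloSet B α E) ≤ sharpTauberian B α * volume E := by
  rcases eq_or_ne (volume E) 0 with h0 | h0
  · have hempty : haloSet B α E = ∅ := by
      refine eq_empty_of_forall_notMem fun x hx => ?_
      obtain ⟨R, -, -, h⟩ := (mem_haloSet_iff hB hE).1 hx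
      exact not_lt_zero (h.trans_eq (measure_mono_null inter_subset_left h0))
    simp [hempty]
  · rw [← ENNReal.div_le_iff h0 hfin]
    exact le_iSup_of_le E (le_iSup_of_le hE (le_iSup_of_le h0.bot_lt
      (le_iSup_of_le hfin.lt_top le_rfl)))

theorem IsDensityBasis.ae_exists_forall_lt_measure_inter (hB : IsDensityBasis B)
    (hE : MeasurableSet E) (hα : α < 1) :
    ∀ᵐ x, x ∈ E → ∃ r > 0, ∀ R ∈ B, x ∈ R → Metric.diam R < r →
      ENNReal.ofReal α * volume R < volume (E ∩ R) := by
  filter_upwards [hB.2 _ ((memLp_top_const (1 : ℝ)).indicator hE)] with x hx hxE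
  obtain ⟨r, hr, h⟩ := hx.2 (min (1 - α) 1) (lt_min (sub_pos.2 hα) one_pos)
  refine ⟨r, hr, fun R hR hxR hdiam => ?_⟩
  have hR0 := hB.1.measure_ne_zero hR ⟨x, hxR⟩
  have hdens : max α 0 < (volume (E ∩ R) / volume R).toReal := by
    have hclose := h R hR hxR hdiam
    rw [setAverage_indicator_one volume hE, indicator_of_mem hxE, abs_lt] at hclose
    rw [max_lt_iff]
    constructor <;> linarith [hclose.1, min_le_left (1 - α) 1, min_le_right (1 - α) 1]
  have hfin : volume (E ∩ R) / volume R ≠ ∞ :=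
    ENNReal.div_ne_top (measure_ne_top_of_subset inter_subset_right (hB.1.measure_ne_top hR)) hR0
  rw [← ENNReal.lt_div_iff_mul_lt (Or.inl hR0) (Or.inl (hB.1.measure_ne_top hR))]
  exact (ENNReal.ofReal_le_ofReal (le_max_left _ _)).trans_lt
    ((ENNReal.ofReal_lt_iff_lt_toReal (le_max_right _ _) hfin).2 hdens)

theorem IsDensityBasis.ae_le_haloSet (hB : IsDensityBasis B) (hE : MeasurableSet E) (hα : α < 1) :
    E ≤ᵐ[volume] haloSet B α E := by
  filter_upwards [hB.ae_exists_forall_lt_measure_inter hE hα, hB.2 _ (memLp_top_const (0 : ℝ))]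
    with x hdens hx hxE
  obtain ⟨r, hr, h⟩ := hdens hxE
  obtain ⟨R, hR, hxR, hdiam⟩ := hx.1 r hr
  exact subset_haloSet hB.1 hE hR (h R hR hxR hdiam) hxR

theorem one_le_sharpTauberian (hB : IsDensityBasis B) (hα : α < 1) : 1 ≤ sharpTauberian B α := by
  set U := Metric.ball (0 : EuclideanSpace ℝ (Fin n)) 1
  have hU : volume U ≠ ∞ := measure_ball_lt_top.ne
  have h : volume U ≤ sharpTauberian B α * volume U :=
    (measure_mono_ae (hB.ae_le_haloSet measurableSet_ball hα)).trans
      (measure_haloSet_le hB.1 measurableSet_ball hU α)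
  rwa [← ENNReal.mul_le_mul_iff_left (Metric.measure_ball_pos volume _ one_pos).ne' hU, one_mul]

theorem HomothecyInvariant.image_homothety_mem (hhom : HomothecyInvariant B) (hR : R ∈ B)
    (x : EuclideanSpace ℝ (Fin n)) {t : ℝ} (ht : 0 < t) : homothety x t '' R ∈ B := by
  rw [image_homothety_eq_vadd_smul, ← image_smul, ← image_vadd, image_image]
  exact hhom R hR t ht (x - t • x)

theorem ae_exists_homothety_density (hB : IsDensityBasis B) (hhom : HomothecyInvariant B)
    (hE : MeasurableSet E) (hR : R ∈ B) (hconv : Convex ℝ R) (hη : η ∈ Ioo 0 1)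
    (hle : volume (E ∩ R) ≤ ENNReal.ofReal (1 - η) * volume R) :
    ∀ᵐ x, x ∈ E ∩ R → ∃ t ∈ Ioc (0 : ℝ) 1,
      ENNReal.ofReal (1 - η) * volume (homothety x t '' R) < volume (E ∩ homothety x t '' R) ∧
      ENNReal.ofReal (η / 2) * volume (homothety x t '' R) ≤
        volume (homothety x t '' R \ E) := by
  filter_upwards [hB.ae_exists_forall_lt_measure_inter hE (sub_lt_self 1 hη.1)] with x hx hxER
  obtain ⟨r, hr, h⟩ := hx hxER.1
  have hxt : ∀ t : ℝ, x ∈ homothety x t '' R := fun t => ⟨x, hxER.2, by simp⟩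
  have hsmall : ∀ᶠ t in 𝓝[>] (0 : ℝ), ENNReal.ofReal (1 - η) * volume (homothety x t '' R) <
      volume (E ∩ homothety x t '' R) := by
    have hdiam : Tendsto (fun t => t * Metric.diam R) (𝓝[>] (0 : ℝ)) (𝓝 0) :=
      ((continuous_mul_const _).tendsto' _ _ (zero_mul _)).mono_left nhdsWithin_le_nhds
    filter_upwards [self_mem_nhdsWithin, hdiam.eventually_lt_const hr] with t (ht : 0 < t) htr
    refine h _ (hhom.image_homothety_mem hR x ht) (hxt t) ?_
    rwa [diam_image_homothety x ht.le]
  have hlt : ENNReal.ofReal (1 - η) < ENNReal.ofReal (1 - η / 2) :=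
    (ENNReal.ofReal_lt_ofReal_iff (by linarith [hη.2])).2 (by linarith [hη.1])
  obtain ⟨t, ht, hgt, hle'⟩ :=
    exists_homothety_density_between volume (hconv hxER.2) hlt hle hsmall
  refine ⟨t, ht, hgt, mul_measure_le_measure_sdiff hE
    (hB.1.measure_ne_top (hhom.image_homothety_mem hR x ht.1)) ?_ hle'⟩
  rw [← ENNReal.ofReal_add (by linarith [hη.2]) (by linarith [hη.1]), sub_add_cancel,
    ENNReal.ofReal_one]

/-- The rate `c` at which halo sets gain density: if `E` has density at most `1 - η` in a convex
`R ∈ B`, then the `(1 - η)`-halo set of `E` has at least `1 + c * η` times the measure of `E` in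
`R`. The factor `12 ^ n` comes from the Vitali covering and the factor `2` from stopping at
density `1 - η / 2`. -/
noncomputable def gainConst (n : ℕ) : ℝ := 1 / (2 * 12 ^ n)

theorem gainConst_pos (n : ℕ) : 0 < gainConst n := by
  unfold gainConst
  positivity

theorem gainConst_le_one (n : ℕ) : gainConst n ≤ 1 := by
  unfold gainConst
  rw [div_le_one (by positivity)]
  linarith [one_le_pow₀ (M₀ := ℝ) (a := 12) (n := n) (by norm_num)]

theorem twelve_pow_mul_ofReal_gainConst_mul (n : ℕ) (η : ℝ) :
    12 ^ n * ENNReal.ofReal (gainConst n * η) = ENNReal.ofReal (η / 2) := by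
  rw [← ENNReal.ofReal_ofNat, ← ENNReal.ofReal_pow (by norm_num),
    ← ENNReal.ofReal_mul (by positivity), gainConst]
  congr 1
  field_simp

theorem mul_measure_inter_le_measure_haloSet_inter (hB : IsDensityBasis B)
    (hhom : HomothecyInvariant B) (hE : MeasurableSet E) (hR : R ∈ B) (hconv : Convex ℝ R)
    (hη : η ∈ Ioo 0 1) (hle : volume (E ∩ R) ≤ ENNReal.ofReal (1 - η) * volume R) :
    ENNReal.ofReal (1 + gainConst n * η) * volume (E ∩ R) ≤
      volume (haloSet B (1 - η) E ∩ R) := by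
  set H := haloSet B (1 - η) E
  have hcover : ∀ᵐ x, x ∈ E ∩ R → ∃ t ∈ Ioc (0 : ℝ) 1,
      ENNReal.ofReal (η / 2) * volume (homothety x t '' R) ≤
        volume (homothety x t '' R ∩ ((H ∩ R) \ E)) := by
    filter_upwards [ae_exists_homothety_density hB hhom hE hR hconv hη hle] with x hx hxER
    obtain ⟨t, ht, hgt, hsdiff⟩ := hx hxER
    refine ⟨t, ht, hsdiff.trans (measure_mono fun y hy => ⟨hy.1, ⟨?_, ?_⟩, hy.2⟩)⟩
    · exact subset_haloSet hB.1 hE (hhom.image_homothety_mem hR x ht.1) hgt hy.1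
    · exact image_homothety_subset (hconv hxER.2) (Ioc_subset_Icc_self ht) hy.1
  have hgain : ENNReal.ofReal (gainConst n * η) * volume (E ∩ R) ≤ volume ((H ∩ R) \ E) := by
    have h := mul_measure_le_of_ae_exists_homothety volume hconv (hB.1 R hR).1 inter_subset_right
      hcover
    rw [finrank_euclideanSpace_fin, ← twelve_pow_mul_ofReal_gainConst_mul, mul_assoc] at h
    exact (ENNReal.mul_le_mul_iff_right (by simp) (by simp)).1 h
  have hkeep : volume (E ∩ R) ≤ volume ((H ∩ R) ∩ E) := measure_mono_ae <| by
    filter_upwards [hB.ae_le_haloSet hE (sub_lt_self 1 hη.1)] with x hx hxER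
      using ⟨⟨hx hxER.1, hxER.2⟩, hxER.1⟩
  rw [← measure_inter_add_sdiff (H ∩ R) hE, ENNReal.ofReal_add zero_le_one
    (mul_nonneg (gainConst_pos n).le hη.1.le), ENNReal.ofReal_one, add_mul, one_mul]
  exact add_le_add hkeep hgain

theorem haloSet_subset_haloSet_haloSet (hB : IsDensityBasis B) (hhom : HomothecyInvariant B)
    (hconv : ∀ R ∈ B, Convex ℝ R) (hE : MeasurableSet E) (hη : η ∈ Ioo 0 1)
    (hα : α * (1 + gainConst n * η) < 1) :
    haloSet B α E ⊆ haloSet B (α * (1 + gainConst n * η)) (haloSet B (1 - η) E) := by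
  intro x hx
  obtain ⟨R, hR, hxR, h⟩ := (mem_haloSet_iff hB.1 hE).1 hx
  refine subset_haloSet hB.1 (isOpen_haloSet hB.1 hE _).measurableSet hR ?_ hxR
  have hgain : 0 < 1 + gainConst n * η :=
    add_pos one_pos (mul_pos (gainConst_pos n) hη.1)
  rcases le_or_gt (volume (E ∩ R)) (ENNReal.ofReal (1 - η) * volume R) with hle | hlt
  · calc ENNReal.ofReal (α * (1 + gainConst n * η)) * volume R
        = ENNReal.ofReal (1 + gainConst n * η) * (ENNReal.ofReal α * volume R) := by
          rw [mul_comm α, ENNReal.ofReal_mul hgain.le, mul_assoc]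
      _ < ENNReal.ofReal (1 + gainConst n * η) * volume (E ∩ R) :=
          (ENNReal.mul_lt_mul_iff_right (by simpa using hgain) ENNReal.ofReal_ne_top).2 h
      _ ≤ volume (haloSet B (1 - η) E ∩ R) :=
          mul_measure_inter_le_measure_haloSet_inter hB hhom hE hR (hconv R hR) hη hle
  · rw [inter_eq_self_of_subset_right (subset_haloSet hB.1 hE hR hlt)]
    calc ENNReal.ofReal (α * (1 + gainConst n * η)) * volume R < 1 * volume R :=
          (ENNReal.mul_lt_mul_iff_left (hB.1.measure_ne_zero hR ⟨x, hxR⟩)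
            (hB.1.measure_ne_top hR)).2 (ENNReal.ofReal_lt_one.2 hα)
      _ = volume R := one_mul _

theorem sharpTauberian_le_mul (hB : IsDensityBasis B) (hhom : HomothecyInvariant B)
    (hconv : ∀ R ∈ B, Convex ℝ R) (hη : η ∈ Ioo 0 1) (hα : α * (1 + gainConst n * η) < 1) :
    sharpTauberian B α ≤
      sharpTauberian B (α * (1 + gainConst n * η)) * sharpTauberian B (1 - η) := by
  rcases eq_or_ne (sharpTauberian B (1 - η)) ∞ with htop | hfin
  · rw [htop, ENNReal.mul_top (one_pos.trans_le (one_le_sharpTauberian hB hα)).ne']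
    exact le_top
  refine iSup_le fun E => iSup_le fun hE => iSup_le fun h0 => iSup_le fun hEtop => ?_
  have hH := measure_haloSet_le hB.1 hE hEtop.ne (1 - η)
  rw [ENNReal.div_le_iff h0.ne' hEtop.ne, mul_assoc]
  calc volume (haloSet B α E)
      ≤ volume (haloSet B (α * (1 + gainConst n * η)) (haloSet B (1 - η) E)) :=
        measure_mono (haloSet_subset_haloSet_haloSet hB hhom hconv hE hη hα)
    _ ≤ sharpTauberian B (α * (1 + gainConst n * η)) * volume (haloSet B (1 - η) E) :=
        measure_haloSet_le hB.1 (isOpen_haloSet hB.1 hE _).measurableSet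
          (ne_top_of_le_ne_top (ENNReal.mul_ne_top hfin hEtop.ne) hH) _
    _ ≤ sharpTauberian B (α * (1 + gainConst n * η)) *
        (sharpTauberian B (1 - η) * volume E) := by gcongr

end HaloSet

section Holder

theorem holderOnWith_congr {X Y : Type*} [PseudoEMetricSpace X] [PseudoEMetricSpace Y]
    {f g : X → Y} {C p : ℝ≥0} {s : Set X} (hf : HolderOnWith C p f s) (hfg : EqOn f g s) :
    HolderOnWith C p g s := fun x hx y hy => by
  rw [← hfg hx, ← hfg hy]
  exact hf x hx y hy

variable {f : ℝ → ℝ} {p : ℝ≥0} {a b C δ : ℝ}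

theorem holderOnWith_of_sub_le {s : Set ℝ} (hf : MonotoneOn f s)
    (h : ∀ x ∈ s, ∀ y ∈ s, x < y → f y - f x ≤ C * (y - x) ^ (p : ℝ)) :
    HolderOnWith C.toNNReal p f s := by
  intro x hx y hy
  wlog hxy : x ≤ y generalizing x y
  · rw [edist_comm, edist_comm x y]
    exact this y hy x hx (le_of_not_ge hxy)
  rcases hxy.eq_or_lt with rfl | hlt
  · simp
  have hpow : 0 ≤ (y - x) ^ (p : ℝ) := Real.rpow_nonneg (sub_pos.2 hlt).le _
  rw [edist_comm, edist_comm x y, edist_dist, edist_dist, Real.dist_eq, Real.dist_eq,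
    abs_of_nonneg (sub_nonneg.2 (hf hx hy hxy)), abs_of_pos (sub_pos.2 hlt),
    ENNReal.ofReal_rpow_of_pos (sub_pos.2 hlt)]
  exact (ENNReal.ofReal_le_ofReal (h x hx y hy hlt)).trans_eq (ENNReal.ofReal_mul' hpow)

theorem exists_holderOnWith_Icc (hf : MonotoneOn f (Icc a b)) (hδ : 0 < δ)
    (h : ∀ x ∈ Icc a b, ∀ y ∈ Icc a b, x < y → y - x < δ → f y - f x ≤ C * (y - x) ^ (p : ℝ)) :
    ∃ A : ℝ≥0, HolderOnWith A p f (Icc a b) := by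
  refine ⟨_, holderOnWith_of_sub_le (C := max C ((f b - f a) / δ ^ (p : ℝ))) hf
    fun x hx y hy hxy => ?_⟩
  have hpow : 0 ≤ (y - x) ^ (p : ℝ) := Real.rpow_nonneg (sub_pos.2 hxy).le _
  rcases lt_or_ge (y - x) δ with hsmall | hlarge
  · exact (h x hx y hy hxy hsmall).trans (mul_le_mul_of_nonneg_right (le_max_left _ _) hpow)
  · have hab : a ≤ b := hx.1.trans hx.2
    have hfx : f a ≤ f x := hf (left_mem_Icc.2 hab) hx hx.1
    have hfy : f y ≤ f b := hf hy (right_mem_Icc.2 hab) hy.2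
    have hfab : f a ≤ f b := hf (left_mem_Icc.2 hab) (right_mem_Icc.2 hab) hab
    calc f y - f x ≤ f b - f a := by linarith
      _ = (f b - f a) / δ ^ (p : ℝ) * δ ^ (p : ℝ) :=
          (div_mul_cancel₀ _ (Real.rpow_pos_of_pos hδ _).ne').symm
      _ ≤ (f b - f a) / δ ^ (p : ℝ) * (y - x) ^ (p : ℝ) := by
          have : 0 ≤ f b - f a := sub_nonneg.2 hfab
          gcongr
      _ ≤ max C ((f b - f a) / δ ^ (p : ℝ)) * (y - x) ^ (p : ℝ) :=
          mul_le_mul_of_nonneg_right (le_max_right _ _) hpow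

theorem holderOnWith_union {Y : Type*} [PseudoEMetricSpace Y] {f : ℝ → Y} {C₁ C₂ : ℝ≥0}
    {s t : Set ℝ} (hs : HolderOnWith C₁ p f s) (ht : HolderOnWith C₂ p f t)
    (hb : IsGreatest s b) (hb' : IsLeast t b) : HolderOnWith (C₁ + C₂) p f (s ∪ t) := by
  have hcross : ∀ x ∈ s, ∀ y ∈ t, edist (f x) (f y) ≤ ↑(C₁ + C₂) * edist x y ^ (p : ℝ) := by
    intro x hx y hy
    have hbxy : b ∈ uIcc x y := Icc_subset_uIcc ⟨hb.2 hx, hb'.2 hy⟩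
    have hxb : edist x b ≤ edist x y := by
      simpa only [edist_dist] using ENNReal.ofReal_le_ofReal (Real.dist_left_le_of_mem_uIcc hbxy)
    have hby : edist b y ≤ edist x y := by
      simpa only [edist_dist] using ENNReal.ofReal_le_ofReal (Real.dist_right_le_of_mem_uIcc hbxy)
    calc edist (f x) (f y) ≤ edist (f x) (f b) + edist (f b) (f y) := edist_triangle _ _ _
      _ ≤ C₁ * edist x b ^ (p : ℝ) + C₂ * edist b y ^ (p : ℝ) :=
          add_le_add (hs x hx b hb.1) (ht b hb'.1 y hy)
      _ ≤ C₁ * edist x y ^ (p : ℝ) + C₂ * edist x y ^ (p : ℝ) := by gcongr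
      _ = ↑(C₁ + C₂) * edist x y ^ (p : ℝ) := by rw [ENNReal.coe_add, add_mul]
  rintro x (hx | hx) y (hy | hy)
  · exact hs.mono_const le_self_add x hx y hy
  · exact hcross x hx y hy
  · rw [edist_comm, edist_comm x y]
    exact hcross y hy x hx
  · exact ht.mono_const le_add_self x hx y hy

variable {I J : Set ℝ} {g : ℝ → ℝ}

theorem LocallyHolder.comp (hf : LocallyHolder p f I) (hg : LocallyLipschitzOn J g)
    (hmaps : MapsTo g J I) : LocallyHolder p (fun x => f (g x)) J := by
  intro K hK hKc
  obtain ⟨C, hC⟩ := (hg.mono hK).exists_lipschitzOnWith_of_compact hKc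
  obtain ⟨A, hA⟩ := hf (g '' K) (hmaps.mono_left hK).image_subset (hKc.image_of_continuousOn
    hC.continuousOn)
  have h := hA.comp hC.holderOnWith (mapsTo_image g K)
  rw [mul_one] at h
  exact ⟨_, h⟩

theorem LocallyHolder.congr (hf : LocallyHolder p f I) (hfg : EqOn f g I) :
    LocallyHolder p g I := by
  intro K hK hKc
  obtain ⟨A, hA⟩ := hf K hK hKc
  exact ⟨A, holderOnWith_congr hA (hfg.mono hK)⟩

end Holder

section HaloFunction

variable {n : ℕ} {B : Set (Set (EuclideanSpace ℝ (Fin n)))} {a α η : ℝ} {p : ℝ≥0}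

theorem haloFunction_of_le_one (ha : a ≤ 1) : haloFunction B a = ENNReal.ofReal a := if_pos ha

theorem haloFunction_of_one_lt (ha : 1 < a) : haloFunction B a = sharpTauberian B (1 / a) :=
  if_neg ha.not_ge

theorem haloFunction_inv (hα : α ∈ Ioo 0 1) : haloFunction B α⁻¹ = sharpTauberian B α := by
  rw [haloFunction_of_one_lt ((one_lt_inv₀ hα.1).2 hα.2), one_div, inv_inv]

theorem monotone_haloFunction (hB : IsDensityBasis B) : Monotone (haloFunction B) := by
  intro x y hxy
  rcases le_or_gt y 1 with hy | hy
  · rw [haloFunction_of_le_one hy, haloFunction_of_le_one (hxy.trans hy)]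
    exact ENNReal.ofReal_le_ofReal hxy
  rw [haloFunction_of_one_lt hy]
  rcases le_or_gt x 1 with hx | hx
  · rw [haloFunction_of_le_one hx]
    exact (ENNReal.ofReal_le_one.2 hx).trans
      (one_le_sharpTauberian hB ((div_lt_one (one_pos.trans hy)).2 hy))
  · rw [haloFunction_of_one_lt hx]
    exact antitone_sharpTauberian (one_div_le_one_div_of_le (one_pos.trans hx) hxy)

theorem haloFunction_add_le (hB : IsDensityBasis B) (hhom : HomothecyInvariant B)
    (hconv : ∀ R ∈ B, Convex ℝ R) (ha : 1 ≤ a) (hη : η ∈ Ioo 0 1) :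
    haloFunction B (a + gainConst n * η) ≤ haloFunction B a * sharpTauberian B (1 - η) := by
  have hgain : 0 < gainConst n * η := mul_pos (gainConst_pos n) hη.1
  rw [haloFunction_of_one_lt (by linarith)]
  rcases ha.eq_or_lt with rfl | ha
  · rw [haloFunction_of_le_one le_rfl, ENNReal.ofReal_one, one_mul]
    refine antitone_sharpTauberian ((le_div_iff₀ (by linarith)).2 ?_)
    nlinarith [mul_le_mul_of_nonneg_right (gainConst_le_one n) hη.1.le, hη.1, hη.2]
  · have ha0 : 0 < a := one_pos.trans ha
    have hscale : 1 / (a * (1 + gainConst n * η)) * (1 + gainConst n * η) = 1 / a := by field_simp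
    have hle : a + gainConst n * η ≤ a * (1 + gainConst n * η) := by nlinarith
    calc sharpTauberian B (1 / (a + gainConst n * η))
        ≤ sharpTauberian B (1 / (a * (1 + gainConst n * η))) :=
          antitone_sharpTauberian (one_div_le_one_div_of_le (by linarith) hle)
      _ ≤ sharpTauberian B (1 / a) * sharpTauberian B (1 - η) :=
          hscale ▸ sharpTauberian_le_mul hB hhom hconv hη (hscale ▸ (div_lt_one ha0).2 ha)
      _ = haloFunction B a * sharpTauberian B (1 - η) := by rw [haloFunction_of_one_lt ha]

theorem haloFunction_ne_top (hB : IsDensityBasis B) (hhom : HomothecyInvariant B)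
    (hconv : ∀ R ∈ B, Convex ℝ R) (hη : η ∈ Ioo 0 1) (hfin : sharpTauberian B (1 - η) ≠ ∞)
    (a : ℝ) : haloFunction B a ≠ ∞ := by
  have hgain : 0 < gainConst n * η := mul_pos (gainConst_pos n) hη.1
  have hstep : ∀ k : ℕ, haloFunction B (1 + k * (gainConst n * η)) ≠ ∞ := by
    intro k
    induction k with
    | zero => simp [haloFunction_of_le_one]
    | succ k ih =>
      have h := haloFunction_add_le hB hhom hconv
        (le_add_of_nonneg_right (by positivity : 0 ≤ k * (gainConst n * η))) hη
      rw [Nat.cast_succ, add_one_mul, ← add_assoc]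
      exact ne_top_of_le_ne_top (ENNReal.mul_ne_top ih hfin) h
  obtain ⟨k, hk⟩ := exists_nat_ge (a / (gainConst n * η))
  refine ne_top_of_le_ne_top (hstep k) (monotone_haloFunction hB ?_)
  linarith [(div_le_iff₀ hgain).1 hk]

theorem SolyanikEstimate.exists_forall_le (h : SolyanikEstimate B p) :
    ∃ A : ℝ≥0, ∃ δ ∈ Ioo (0 : ℝ) 1, ∀ η ∈ Ioo 0 δ,
      sharpTauberian B (1 - η) ≤ ENNReal.ofReal (1 + A * η ^ (p : ℝ)) := by
  obtain ⟨A, hA⟩ := h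
  obtain ⟨γ, hγ, hγA⟩ := (mem_nhdsLT_iff_exists_Ioo_subset' (zero_lt_one' ℝ)).1 hA
  refine ⟨A.toNNReal, min (1 - γ) (1 / 2), ⟨by simpa using hγ, by norm_num⟩, fun η hη => ?_⟩
  have hpow : 0 ≤ η ^ (p : ℝ) := Real.rpow_nonneg hη.1.le _
  have hsub : sharpTauberian B (1 - η) - 1 ≤ ENNReal.ofReal (A * (1 - (1 - η)) ^ (p : ℝ)) :=
    hγA ⟨by linarith [hη.2, min_le_left (1 - γ) (1 / 2)], by linarith [hη.1]⟩
  rw [sub_sub_cancel, tsub_le_iff_left] at hsub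
  rw [ENNReal.ofReal_add zero_le_one (by positivity), ENNReal.ofReal_one]
  refine hsub.trans ?_
  gcongr
  exact Real.le_coe_toNNReal A

theorem SolyanikEstimate.haloFunction_ne_top (hsol : SolyanikEstimate B p)
    (hB : IsDensityBasis B) (hhom : HomothecyInvariant B) (hconv : ∀ R ∈ B, Convex ℝ R) (a : ℝ) :
    haloFunction B a ≠ ∞ := by
  obtain ⟨A, δ, hδ, h⟩ := hsol.exists_forall_le
  have hη : δ / 2 ∈ Ioo 0 δ := ⟨half_pos hδ.1, half_lt_self hδ.1⟩
  exact Halo.haloFunction_ne_top hB hhom hconv ⟨hη.1, hη.2.trans hδ.2⟩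
    (ne_top_of_le_ne_top ENNReal.ofReal_ne_top (h _ hη)) a

theorem SolyanikEstimate.monotone_toReal_haloFunction (hsol : SolyanikEstimate B p)
    (hB : IsDensityBasis B) (hhom : HomothecyInvariant B) (hconv : ∀ R ∈ B, Convex ℝ R) :
    Monotone fun a => (haloFunction B a).toReal := fun _ y hxy =>
  ENNReal.toReal_mono (hsol.haloFunction_ne_top hB hhom hconv y) (monotone_haloFunction hB hxy)

theorem SolyanikEstimate.exists_holderOnWith_Icc_one (hsol : SolyanikEstimate B p)
    (hB : IsDensityBasis B) (hhom : HomothecyInvariant B) (hconv : ∀ R ∈ B, Convex ℝ R) (b : ℝ) :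
    ∃ C : ℝ≥0, HolderOnWith C p (fun a => (haloFunction B a).toReal) (Icc 1 b) := by
  obtain ⟨A, δ, hδ, hA⟩ := hsol.exists_forall_le
  set φ : ℝ → ℝ := fun a => (haloFunction B a).toReal
  have hc := gainConst_pos n
  have hmono : Monotone φ := hsol.monotone_toReal_haloFunction hB hhom hconv
  refine exists_holderOnWith_Icc (C := φ b * (A / gainConst n ^ (p : ℝ))) (hmono.monotoneOn _)
    (mul_pos hc hδ.1) fun x hx y _ hxy hyx => ?_
  set η := (y - x) / gainConst n with hη
  have hηδ : η ∈ Ioo 0 δ := ⟨div_pos (sub_pos.2 hxy) hc, (div_lt_iff₀' hc).2 hyx⟩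
  have hy : x + gainConst n * η = y := by rw [hη, mul_div_cancel₀ _ hc.ne', add_sub_cancel]
  have hfactor : 0 ≤ 1 + A * η ^ (p : ℝ) :=
    add_nonneg zero_le_one (mul_nonneg A.coe_nonneg (Real.rpow_nonneg hηδ.1.le _))
  have hle : φ y ≤ φ x * (1 + A * η ^ (p : ℝ)) := by
    have h : haloFunction B y ≤ haloFunction B x * ENNReal.ofReal (1 + A * η ^ (p : ℝ)) :=
      hy ▸ (haloFunction_add_le hB hhom hconv hx.1 ⟨hηδ.1, hηδ.2.trans hδ.2⟩).trans
        (mul_le_mul_right (hA η hηδ) _)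
    have h' := ENNReal.toReal_mono (ENNReal.mul_ne_top
      (hsol.haloFunction_ne_top hB hhom hconv x) ENNReal.ofReal_ne_top) h
    rwa [ENNReal.toReal_mul, ENNReal.toReal_ofReal hfactor] at h'
  calc φ y - φ x ≤ φ x * (A * η ^ (p : ℝ)) := by linarith
    _ ≤ φ b * (A * η ^ (p : ℝ)) := by
        gcongr
        exact hmono hx.2
    _ = φ b * (A / gainConst n ^ (p : ℝ)) * (y - x) ^ (p : ℝ) := by
        rw [hη, Real.div_rpow (sub_pos.2 hxy).le hc.le]
        ring

theorem exists_holderOnWith_haloFunction_Icc_zero_one (hp : p ≤ 1) :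
    ∃ C : ℝ≥0, HolderOnWith C p (fun a => (haloFunction B a).toReal) (Icc 0 1) := by
  have hid : HolderOnWith 1 1 id (Icc (0 : ℝ) 1) := holderWith_id.holderOnWith _
  have hdiam : ∀ x ∈ Icc (0 : ℝ) 1, ∀ y ∈ Icc (0 : ℝ) 1, edist x y ≤ (1 : ℝ≥0) :=
    fun x hx y hy => by simpa [edist_dist] using Real.dist_le_of_mem_Icc_01 hx hy
  refine ⟨_, holderOnWith_congr (hid.of_le hdiam hp) fun x hx => ?_⟩
  simp only [haloFunction_of_le_one hx.2, ENNReal.toReal_ofReal hx.1, id_eq]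

theorem SolyanikEstimate.locallyHolder_haloFunction (hsol : SolyanikEstimate B p) (hp : p ≤ 1)
    (hB : IsDensityBasis B) (hhom : HomothecyInvariant B) (hconv : ∀ R ∈ B, Convex ℝ R) :
    LocallyHolder p (fun a => (haloFunction B a).toReal) (Ici 0) := by
  intro K hK hKc
  obtain ⟨b, hb⟩ := hKc.bddAbove
  obtain ⟨C₁, h₁⟩ := exists_holderOnWith_haloFunction_Icc_zero_one (B := B) hp
  obtain ⟨C₂, h₂⟩ := hsol.exists_holderOnWith_Icc_one hB hhom hconv (max 1 b)
  refine ⟨C₁ + C₂, (holderOnWith_union h₁ h₂ (isGreatest_Icc zero_le_one)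
    (isLeast_Icc (le_max_left 1 b))).mono fun x hx => ?_⟩
  rw [Icc_union_Icc_eq_Icc zero_le_one (le_max_left 1 b)]
  exact ⟨hK hx, (hb hx).trans (le_max_right 1 b)⟩

theorem SolyanikEstimate.locallyHolder_sharpTauberian (hsol : SolyanikEstimate B p) (hp : p ≤ 1)
    (hB : IsDensityBasis B) (hhom : HomothecyInvariant B) (hconv : ∀ R ∈ B, Convex ℝ R) :
    LocallyHolder p (fun α => (sharpTauberian B α).toReal) (Ioo 0 1) := by
  have hinv : LocallyLipschitzOn (Ioo 0 1) (fun α : ℝ => α⁻¹) :=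
    ContDiffOn.locallyLipschitzOn (convex_Ioo 0 1)
      ((contDiffOn_inv ℝ).mono fun x hx => hx.1.ne')
  refine ((hsol.locallyHolder_haloFunction hp hB hhom hconv).comp hinv
    fun x hx => (inv_pos.2 hx.1).le).congr fun α hα => ?_
  exact congrArg ENNReal.toReal (haloFunction_inv hα)

end HaloFunction

theorem mainTheorem1_general (n : ℕ) (B : Set (Set (EuclideanSpace ℝ (Fin n))))
    (hB : IsDensityBasis B) (hhom : HomothecyInvariant B) (hconv : ∀ R ∈ B, Convex ℝ R)
    (p : ℝ≥0) (hp1 : p ≤ 1) (hsol : SolyanikEstimate B p) :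
    ((∀ α ∈ Ioo (0 : ℝ) 1, sharpTauberian B α ≠ ∞) ∧
      LocallyHolder p (fun α => (sharpTauberian B α).toReal) (Ioo 0 1)) ∧
    ((∀ a ∈ Ici (0 : ℝ), haloFunction B a ≠ ∞) ∧
      LocallyHolder p (fun a => (haloFunction B a).toReal) (Ici 0)) := by
  have hφ := hsol.haloFunction_ne_top hB hhom hconv
  have hC : ∀ α ∈ Ioo (0 : ℝ) 1, sharpTauberian B α ≠ ∞ := fun α hα => haloFunction_inv hα ▸ hφ α⁻¹
  exact ⟨⟨hC, hsol.locallyHolder_sharpTauberian hp1 hB hhom hconv⟩, fun a _ => hφ a,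
    hsol.locallyHolder_haloFunction hp1 hB hhom hconv⟩

end Halo

theorem mainTheorem1 (n : ℕ) (B : Set (Set (EuclideanSpace ℝ (Fin n))))
    (hB : Halo.IsDensityBasis B) (hhom : Halo.HomothecyInvariant B)
    (hconv : ∀ R ∈ B, Convex ℝ R)
    (p : ℝ≥0) (hp0 : 0 < p) (hp1 : p < 1) (hsol : Halo.SolyanikEstimate B p) :
    ((∀ α ∈ Ioo (0 : ℝ) 1, Halo.sharpTauberian B α ≠ ∞) ∧
      Halo.LocallyHolder p (fun α => (Halo.sharpTauberian B α).toReal) (Ioo 0 1)) ∧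
    ((∀ a ∈ Ici (0 : ℝ), Halo.haloFunction B a ≠ ∞) ∧
      Halo.LocallyHolder p (fun a => (Halo.haloFunction B a).toReal) (Ici 0)) :=
  Halo.mainTheorem1_general n B hB hhom hconv p hp1.le hsol
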